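/- Throughout, $\log$ is the natural logarithm, $\mathrm e=\exp(1)$, $\Omega_{\max},T,\lambda>0$, $\mathcal M_\lambda(t)=t-2\lambda\lfloor \frac{t}{2\lambda}+\frac12\rfloor$, and $(\Delta s)_k=s_{k+1}-s_k$. **Signal.** Let $x:\mathbb R\to\mathbb R$ be a continuous finite-energy signal whose Fourier transform is supported in the angular frequency band $[-\Omega_{\max},\Omega_{\max}]$, let $\beta_x>0$ satisfy $\beta_x\in2\lambda\mathbb Z$ and $\|x\|_\infty\le\beta_x$, and let $x_k=x(kT)$ and $\tilde x_k=\mathcal M_\lambda(x_k)$ be its samples and modulo samples. **One-bit data.** Let $\tau^{(\ell)}_k$ ($1\le\ell\le m$) be independent $\mathcal N(0,\lambda^2/9)$ thresholds and let $r^{(\ell)}_k=\operatorname{sgn}(\tilde x_k-\tau^{(\ell)}_k)$. Let $I\subseteq\mathbb Z$ be a set of consecutive integers (finite, or infinite such as $I=\mathbb Z$), partitioned into finite nonempty blocks (for finite $I$, one block is allowed). On each block $B$ the randomized Kaczmarz algorithm (RKA) is run, from an arbitrary starting vector and for an arbitrary number of iterations, on the linear inequalities $r^{(\ell)}_k v_k\ge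 r^{(\ell)}_k\tau^{(\ell)}_k$ ($k\in B$, $1\le\ell\le m$): each iteration draws one of the $m|B|$ inequalities uniformly at random, independently of the other draws and of the thresholds, and projects the current iterate onto its half-space. Let $\bar{\tilde x}_k$, $k\in I$, be the output, $e_k=\bar{\tilde x}_k-\tilde x_k$ and $\|\mathbf e\|_\infty=\sup_{k\in I}|e_k|$. **Reconstruction.** Put $N=\left\lceil\frac{\log\lambda-\log\beta_x}{\log(T\Omega_{\max}\mathrm e)}\right\rceil$ and $J=6\beta_x/\lambda$, and suppose that $I$ contains $k_0,k_0+1,\dots,k_0+N+J-1$ (automatic if $I=\mathbb Z$). For a sequence $s$ let $\nabla s$ be the sequence with $\Delta\nabla s=s$ and $(\nabla s)_{k_0}=0$. From $\bar{\tilde{\mathbf x}}$ compute $s_0=\mathcal M_\lambda(\Delta^N\bar{\tilde{\mathbf x}})-\Delta^N\bar{\tilde{\mathbf x}}$, then for $p=0,\dots,N-2$ $$\kappa_p=\left\lfloor\frac{(\nabla^2s_p)_{k_0}-(\nabla^2s_p)_{k_0+J}}{12\beta_x}+\frac12\right\rfloor,\qquad s_{p+1}=2\lambda\left\lceil\frac{\lfloor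 \nabla s_p/\lambda\rfloor}{2}\right\rceil+2\lambda\kappa_p ,$$ and finally $\bar{\mathbf x}=\nabla s_{N-1}+\bar{\tilde{\mathbf x}}$. **Theorem.** For every outcome of the random experiment with $\|\mathbf e\|_\infty<\infty$, a sufficient condition for $\bar{\mathbf x}$ to recover the samples $x_k$ from the one-bit data, up to the error $\mathbf e$ and an additive multiple of $2\lambda$, i.e. for the existence of $c\in\mathbb Z$ with $$\bar x_k=x_k+e_k+2\lambda c\qquad\text{for all }k\in I,$$ is $$T\le\frac1{2^h\,\Omega_{\max}\,\mathrm e},$$ where $h\ge1$ is an integer with $$h\ge\frac{\log(2\beta_x/\lambda)}{\log\left(\lambda/(4\|\mathbf e\|_\infty)\right)}$$ (the right-hand side being read as $0$ if $\mathbf e=0$ on $I$) and $\lambda\ge4\zeta\|\mathbf e\|_\infty$ for some $\zeta>1$. -/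

import Mathlib

open MeasureTheory ProbabilityTheory
open scoped FourierTransform Matrix

noncomputable section

namespace UNO

/-! ### Signals and folding -/

/-- The (real) Paley-Wiener space of bandwidth `W`: continuous functions `x : ℝ → ℝ` of finite
energy whose `L²` Fourier transform vanishes almost everywhere outside the angular frequency band
`[-W, W]`. Continuity selects the representative that can be sampled. The transform is
`𝓕 x (ξ) = ∫ x(t) exp(-2πi ξ t) dt`, so the angular frequency is `2πξ`. -/
def PaleyWiener (W : ℝ) : Set (ℝ → ℝ) :=
  {x | Continuous x ∧ ∃ hx : MemLp (fun t => (x t : ℂ)) 2 (volume : Measure ℝ),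
    ∀ᵐ ξ : ℝ, W < |2 * Real.pi * ξ| → (𝓕 (hx.toLp (fun t => (x t : ℂ)))) ξ = 0}

/-- Folding of a real number to `[-lam, lam)`. -/
def fold (lam t : ℝ) : ℝ := t - 2 * lam * ⌊t / (2 * lam) + 1 / 2⌋

/-- The modulo samples of `x` with sampling interval `T`. -/
def moduloSample (lam T : ℝ) (x : ℝ → ℝ) (k : ℤ) : ℝ := fold lam (x (k * T))

/-! ### One-bit samples and the randomized Kaczmarz algorithm -/

/-- One-bit samples of a real sequence `y`, one sign for each threshold sequence `τ l`. -/
def oneBit {m : ℕ} (y : ℤ → ℝ) (τ : Fin m → ℤ → ℝ) (l : Fin m) (k : ℤ) : ℝ :=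
  Real.sign (y k - τ l k)

/-- The stacked sign matrix, with blocks `diag (r l)`. -/
def signMatrix {m : ℕ} {κ : Type*} [DecidableEq κ] (r : Fin m → κ → ℝ) :
    Matrix (Fin m × κ) κ ℝ :=
  Matrix.of fun j => Matrix.diagonal (r j.1) j.2

/-- One step of the Kaczmarz method for the system of inequalities `C v ≤ b`: projection of `v`
onto the half-space of row `j`. -/
def kaczmarzStep {ρ κ : Type*} [Fintype κ] (C : Matrix ρ κ ℝ) (b : ρ → ℝ) (j : ρ) (v : κ → ℝ) :
    κ → ℝ :=
  v - (max (C j ⬝ᵥ v - b j) 0 / (C j ⬝ᵥ C j)) • C j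

/-- The iterates of the Kaczmarz method for `C v ≤ b`, started at `v₀`, where the `i`-th step uses
row `rows i`. -/
def kaczmarz {ρ κ : Type*} [Fintype κ] (C : Matrix ρ κ ℝ) (b : ρ → ℝ) (rows : ℕ → ρ)
    (v₀ : κ → ℝ) : ℕ → κ → ℝ
  | 0 => v₀
  | i + 1 => kaczmarzStep C b (rows i) (kaczmarz C b rows v₀ i)

/-- The Kaczmarz method applied to the one-bit polyhedron
`{v | r l k * v k ≥ r l k * τ l k for all l, k}` of a finite set of sample positions. -/
def oneBitRKA {m : ℕ} {κ : Type*} [Fintype κ] [DecidableEq κ] (r τ : Fin m → κ → ℝ)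
    (rows : ℕ → Fin m × κ) (v₀ : κ → ℝ) (i : ℕ) : κ → ℝ :=
  kaczmarz (-signMatrix r) (fun j => -(r j.1 j.2 * τ j.1 j.2)) rows v₀ i

/-- The random experiment. The thresholds `τ l k` are independent `N(0, lam² / 9)` variables. For
each block `B a` of sample positions, `rows a 0, rows a 1, …` are the rows drawn by the algorithm,
uniformly among the `m * #(B a)` inequalities of that block. All draws are independent, and
independent of the thresholds. -/
structure IsExperiment {Ω' ι : Type*} [MeasurableSpace Ω'] (P : Measure Ω') (lam : ℝ) {m : ℕ}
    (B : ι → Finset ℤ) (τ : Fin m → ℤ → Ω' → ℝ)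
    (rows : (a : ι) → ℕ → Ω' → Fin m × (B a)) : Prop where
  threshold_law : ∀ l k, HasLaw (τ l k) (gaussianReal 0 (lam ^ 2 / 9).toNNReal) P
  threshold_indep : iIndepFun (fun q : Fin m × ℤ => τ q.1 q.2) P
  rows_law : ∀ a i, HasLaw (rows a i) (uniformOn Set.univ) P
  rows_indep : iIndepFun (fun q : ι × ℕ => rows q.1 q.2) P
  indep : IndepFun (fun ω (q : Fin m × ℤ) => τ q.1 q.2 ω) (fun ω (q : ι × ℕ) => rows q.1 q.2 ω) P

/-! ### Reconstruction from (perturbed) modulo samples -/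

/-- The inverse-difference operator with base point `k₀`: the solution `f` of
`f (k + 1) - f k = s k`, `f k₀ = 0`. -/
def invDiff (k₀ : ℤ) (s : ℤ → ℝ) (k : ℤ) : ℝ :=
  ∑ b ∈ Finset.Ico k₀ k, s b - ∑ b ∈ Finset.Ico k k₀, s b

/-- Rounding to the lattice `2 lam ℤ`. -/
def roundLattice (lam t : ℝ) : ℝ := 2 * lam * ⌈(⌊t / lam⌋ : ℝ) / 2⌉

/-- The order of differences used in the reconstruction. -/
def diffOrder (lam β T W : ℝ) : ℕ :=
  ⌈(Real.log lam - Real.log β) / Real.log (T * W * Real.exp 1)⌉₊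

/-- The look-ahead `J = 6 β / lam` (a natural number when `β ∈ 2 lam ℤ` is positive). -/
def lookAhead (lam β : ℝ) : ℕ := ⌊6 * β / lam⌋₊

/-- The integer that fixes the constant of integration. -/
def kappa (lam β : ℝ) (k₀ : ℤ) (s : ℤ → ℝ) : ℤ :=
  ⌊(invDiff k₀ (invDiff k₀ s) k₀ - invDiff k₀ (invDiff k₀ s) (k₀ + lookAhead lam β)) / (12 * β)
    + 1 / 2⌋

/-- One pass of the loop: integrate, round, and add the constant of integration. -/
def integrateStep (lam β : ℝ) (k₀ : ℤ) (s : ℤ → ℝ) (k : ℤ) : ℝ :=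
  roundLattice lam (invDiff k₀ s k) + 2 * lam * kappa lam β k₀ s

/-- The unlimited sampling reconstruction from (approximate) modulo samples `y`, with `N` the
difference order: start from `s₀ = fold (Δᴺ y) - Δᴺ y`, make `N - 1` passes of the loop, integrate
once more and add `y`. -/
def reconstruct (lam β T W : ℝ) (k₀ : ℤ) (y : ℤ → ℝ) (k : ℤ) : ℝ :=
  let N := diffOrder lam β T W
  let d : ℤ → ℝ := (fwdDiff (1 : ℤ))^[N] y
  let s₀ : ℤ → ℝ := fun j => fold lam (d j) - d j
  invDiff k₀ ((integrateStep lam β k₀)^[N - 1] s₀) k + y k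

/-- The supremum of `|e k|` over `k ∈ I`. -/
def supNorm (I : Set ℤ) (e : ℤ → ℝ) : ℝ := ⨆ k : I, |e k|

end UNO

end

namespace UNO

/-! ### Bernstein's inequality for band-limited functions -/

/-! The argument fixes an outcome and treats the algorithm's output as `y = γ - ε`, with `γ = x + e`
and `ε = 2λn` for the integer folding numbers `n`. Once `ε` is known up to a constant, so is `γ`.

High differences of `γ` are small. Bernstein's inequality gives `|Δ^N x| ≤ (TΩ)^N β`, and `N` is
chosen so that `(TΩe)^N β ≤ λ`; the spare factor `e^N ≥ 2` leaves `λ/2`. The error satisfies `|Δ^N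
e| ≤ 2^N ‖e‖`, and the condition on `h` keeps this below `λ/2`. Thus `|Δ^N γ| < λ`; since `Δ^N ε`
lies in `2λℤ`, folding `Δ^N y` returns `Δ^N γ`, and `s₀ = Δ^N ε` exactly (`fold_sub_lattice`).

Each pass of the loop undoes one difference without error. The constant of integration is a multiple
of `2λ`, and it is read off from the growth of a second antidifference over `J` steps, because the
lower differences of `ε` stay below `3β` (`integrateStep_eq`). The last integration has no such
correction, so only the folding number at `k₀` is lost (`reconstruct_eq`).

Bernstein's inequality comes from expanding the multiplier `iξ` on the band by the triangle wave
series. This writes `f'` as a series of differences of translates of `f` whose weights have total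
mass exactly `W`. -/

theorem hasSum_odd_cos {x : ℝ} (h0 : 0 ≤ x) (h1 : x ≤ 1 / 2) :
    HasSum (fun j : ℕ => 1 / (2 * (j : ℝ) + 1) ^ 2 * Real.cos (2 * Real.pi * (2 * j + 1) * x))
      (Real.pi ^ 2 * (1 / 8 - x / 2)) := by
  have key : ∀ {z : ℝ}, z ∈ Set.Icc (0 : ℝ) 1 →
      HasSum (fun n : ℕ => 1 / (n : ℝ) ^ 2 * Real.cos (2 * Real.pi * n * z))
        (Real.pi ^ 2 * (z ^ 2 - z + 6⁻¹)) := by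
    intro z hz
    convert! hasSum_one_div_nat_pow_mul_cos one_ne_zero hz using 1
    have := bernoulliFun_two z
    rw [bernoulliFun] at this
    simp only [mul_one, this]
    rw [show ((2 : ℕ).factorial : ℝ) = 2 by norm_num [Nat.factorial]]
    ring
  have hS := key (z := x) ⟨h0, by linarith⟩
  have hE : HasSum (fun j : ℕ => 1 / ((2 * j : ℕ) : ℝ) ^ 2 *
      Real.cos (2 * Real.pi * ((2 * j : ℕ) : ℝ) * x))
      (Real.pi ^ 2 * ((2 * x) ^ 2 - 2 * x + 6⁻¹) / 4) := by
    convert! (key (z := 2 * x) ⟨by linarith, by linarith⟩).div_const 4 using 2 with j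
    push_cast
    rw [show 2 * Real.pi * (2 * (j : ℝ)) * x = 2 * Real.pi * j * (2 * x) by ring]
    -- The term at `j = 0` vanishes on both sides, since division by zero is zero.
    rcases eq_or_ne (j : ℝ) 0 with h | h
    · simp [h]
    · field_simp
      ring
  have hinj : Function.Injective fun j : ℕ => 2 * j + 1 := fun a b h => by
    simpa using h
  obtain ⟨c, hO⟩ : ∃ c, HasSum (fun j : ℕ => 1 / ((2 * j + 1 : ℕ) : ℝ) ^ 2 *
      Real.cos (2 * Real.pi * ((2 * j + 1 : ℕ) : ℝ) * x)) c :=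
    hS.summable.comp_injective hinj
  have hc := (HasSum.even_add_odd (f := fun n : ℕ => 1 / (n : ℝ) ^ 2 *
    Real.cos (2 * Real.pi * n * x)) hE hO).unique hS
  rw [show Real.pi ^ 2 * (1 / 8 - x / 2) = c by linear_combination -hc]
  simpa using hO

theorem hasSum_odd_inv_sq :
    HasSum (fun j : ℕ => 1 / (2 * (j : ℝ) + 1) ^ 2) (Real.pi ^ 2 / 8) := by
  convert! hasSum_odd_cos (x := 0) le_rfl (by norm_num) using 1
  · simp
  · ring

/-- The Fourier series of the triangle wave. -/
theorem hasSum_triangle {u : ℝ} (hu : |u| ≤ 1) :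
    HasSum (fun j : ℕ => (-1) ^ j / (2 * (j : ℝ) + 1) ^ 2 *
      Real.sin ((2 * j + 1) * Real.pi / 2 * u)) (Real.pi ^ 2 / 8 * u) := by
  obtain ⟨hu1, hu2⟩ := abs_le.1 hu
  convert! hasSum_odd_cos (x := (1 - u) / 4) (by linarith) (by linarith) using 1
  · funext j
    have : Real.cos (2 * Real.pi * (2 * j + 1) * ((1 - u) / 4)) =
        (-1) ^ j * Real.sin ((2 * j + 1) * Real.pi / 2 * u) := by
      rw [show 2 * Real.pi * (2 * j + 1) * ((1 - u) / 4) =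
        (Real.pi / 2 - (2 * j + 1) * Real.pi / 2 * u) + j * Real.pi by ring,
        Real.cos_add_nat_mul_pi, Real.cos_pi_div_two_sub]
    rw [this]
    ring
  · ring

/-- The weights of Bernstein's interpolation formula. -/
noncomputable def bernsteinCoeff (W : ℝ) (j : ℕ) : ℝ :=
  W * (4 / Real.pi ^ 2) * ((-1) ^ j / (2 * (j : ℝ) + 1) ^ 2)

/-- The nodes of Bernstein's interpolation formula. -/
noncomputable def bernsteinNode (W : ℝ) (j : ℕ) : ℝ := (2 * j + 1) * Real.pi / (2 * W)

theorem hasSum_abs_bernsteinCoeff {W : ℝ} (hW : 0 < W) :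
    HasSum (fun j => |bernsteinCoeff W j| * 2) W := by
  convert! hasSum_odd_inv_sq.mul_left (W * (8 / Real.pi ^ 2)) using 1
  · funext j
    rw [bernsteinCoeff, abs_mul, abs_div, abs_pow, abs_neg, abs_one, one_pow,
      abs_of_nonneg (by positivity), abs_of_nonneg (by positivity)]
    ring
  · field_simp

/-- The triangle wave is the identity on `[-1, 1]`. At `u = ξ / W` its sine series, written in
exponentials, represents the multiplier of differentiation on the band by translations. -/
theorem hasSum_bernstein {W ξ : ℝ} (hW : 0 < W) (hξ : |ξ| ≤ W) :
    HasSum (fun j => (bernsteinCoeff W j : ℂ) *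
      (Complex.exp (Complex.I * (ξ * bernsteinNode W j)) -
        Complex.exp (Complex.I * (ξ * -bernsteinNode W j)))) (Complex.I * ξ) := by
  have hu : |ξ / W| ≤ 1 := by
    rw [abs_div, abs_of_pos hW]
    exact (div_le_one hW).2 hξ
  have h := ((hasSum_triangle hu).mul_left (W * (8 / Real.pi ^ 2)))
  have h' := (Complex.hasSum_ofReal.2 h).mul_left Complex.I
  convert! h' using 1
  · funext j
    have e1 : (2 * j + 1) * Real.pi / 2 * (ξ / W) = ξ * bernsteinNode W j := by
      rw [bernsteinNode]
      field_simp
    rw [e1]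
    have e2 : Complex.exp (Complex.I * (ξ * bernsteinNode W j)) -
        Complex.exp (Complex.I * (ξ * -bernsteinNode W j)) =
        2 * Complex.I * Complex.sin ((ξ * bernsteinNode W j : ℝ) : ℂ) := by
      rw [show Complex.I * ((ξ : ℂ) * bernsteinNode W j) =
          ((ξ * bernsteinNode W j : ℝ) : ℂ) * Complex.I by push_cast; ring,
        show Complex.I * ((ξ : ℂ) * -bernsteinNode W j) =
          -((ξ * bernsteinNode W j : ℝ) : ℂ) * Complex.I by push_cast; ring,
        Complex.exp_mul_I, Complex.exp_mul_I, Complex.cos_neg, Complex.sin_neg]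
      ring
    rw [e2, bernsteinCoeff]
    push_cast
    ring
  · have : W * (8 / Real.pi ^ 2) * (Real.pi ^ 2 / 8 * (ξ / W)) = ξ := by
      field_simp
    rw [this]

/-- Inverse Fourier transforms of integrable functions supported in the angular frequency band
`[-W, W]`. -/
def IsBandlimited (W : ℝ) (f : ℝ → ℂ) : Prop :=
  ∃ g : ℝ → ℂ, Integrable g ∧ (∀ᵐ ξ : ℝ, W < |2 * Real.pi * ξ| → g ξ = 0) ∧
    ∀ t : ℝ, f t = ∫ ξ : ℝ, Complex.exp (Complex.I * ((2 * Real.pi * ξ : ℝ) * t)) * g ξ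

theorem norm_exp_I_mul (a b : ℝ) : ‖Complex.exp (Complex.I * ((a : ℂ) * b))‖ = 1 := by
  rw [mul_comm, ← Complex.ofReal_mul, Complex.norm_exp_ofReal_mul_I]

theorem integrable_exp_mul {g : ℝ → ℂ} (hg : Integrable g) (t : ℝ) :
    Integrable fun ξ : ℝ => Complex.exp (Complex.I * ((2 * Real.pi * ξ : ℝ) * t)) * g ξ := by
  refine hg.bdd_mul (c := 1) (Continuous.aestronglyMeasurable (by fun_prop)) ?_
  exact .of_forall fun ξ => (norm_exp_I_mul _ _).le

theorem IsBandlimited.fwdDiff {W : ℝ} {f : ℝ → ℂ} (hf : IsBandlimited W f) (T : ℝ) :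
    IsBandlimited W (_root_.fwdDiff T f) := by
  obtain ⟨g, hg, hg0, hfg⟩ := hf
  refine ⟨fun ξ => Complex.exp (Complex.I * ((2 * Real.pi * ξ : ℝ) * T)) * g ξ - g ξ,
    (integrable_exp_mul hg T).sub hg, ?_, fun t => ?_⟩
  · filter_upwards [hg0] with ξ h hξ
    simp [h hξ]
  · rw [_root_.fwdDiff, hfg, hfg,
      ← integral_sub (integrable_exp_mul hg _) (integrable_exp_mul hg _)]
    congr 1
    funext ξ
    rw [mul_sub, ← mul_assoc (Complex.exp _) (Complex.exp _), ← Complex.exp_add]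
    congr 3
    push_cast
    ring

/-- On the band the frequency factor is at most `W`, so `W * ‖g‖` dominates and differentiation
passes under the integral. -/
theorem IsBandlimited.hasDerivAt {W : ℝ} {f g : ℝ → ℂ} (hg : Integrable g)
    (hg0 : ∀ᵐ ξ : ℝ, W < |2 * Real.pi * ξ| → g ξ = 0)
    (hfg : ∀ t : ℝ, f t = ∫ ξ : ℝ, Complex.exp (Complex.I * ((2 * Real.pi * ξ : ℝ) * t)) * g ξ)
    (t : ℝ) :
    HasDerivAt f (∫ ξ : ℝ, Complex.I * (2 * Real.pi * ξ : ℝ) *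
      (Complex.exp (Complex.I * ((2 * Real.pi * ξ : ℝ) * t)) * g ξ)) t := by
  rw [funext hfg]
  refine (hasDerivAt_integral_of_dominated_loc_of_deriv_le (s := Set.univ)
    (F' := fun t ξ => Complex.I * (2 * Real.pi * ξ : ℝ) *
      (Complex.exp (Complex.I * ((2 * Real.pi * ξ : ℝ) * t)) * g ξ))
    (bound := fun ξ => W * ‖g ξ‖) Filter.univ_mem
    (.of_forall fun t => (integrable_exp_mul hg t).aestronglyMeasurable)
    (integrable_exp_mul hg t) ?_ ?_ (hg.norm.const_mul W) ?_).2
  · exact (Continuous.aestronglyMeasurable (by fun_prop)).mul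
      (integrable_exp_mul hg t).aestronglyMeasurable
  · filter_upwards [hg0] with ξ h s _
    by_cases hξ : W < |2 * Real.pi * ξ|
    · simp [h hξ]
    · rw [norm_mul, norm_mul, norm_mul, norm_exp_I_mul, Complex.norm_I, one_mul, one_mul,
        Complex.norm_real, Real.norm_eq_abs]
      gcongr
      exact not_lt.1 hξ
  · refine .of_forall fun ξ s _ => ?_
    have h1 : HasDerivAt (fun s : ℝ => Complex.I * ((2 * Real.pi * ξ : ℝ) * (s : ℂ)))
        (Complex.I * ((2 * Real.pi * ξ : ℝ) * 1)) s :=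
      ((Complex.ofRealCLM.hasDerivAt (x := s)).const_mul _).const_mul _
    convert! (h1.cexp).mul_const (g ξ) using 1
    ring

/-- Bernstein's interpolation formula for `f'`: the multiplier series is integrated termwise against
`g`. Summability of the weights gives the dominating function `W * ‖g‖`. -/
theorem IsBandlimited.hasSum_deriv {W : ℝ} (hW : 0 < W) {f g : ℝ → ℂ} (hg : Integrable g)
    (hg0 : ∀ᵐ ξ : ℝ, W < |2 * Real.pi * ξ| → g ξ = 0)
    (hfg : ∀ t : ℝ, f t = ∫ ξ : ℝ, Complex.exp (Complex.I * ((2 * Real.pi * ξ : ℝ) * t)) * g ξ)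
    (t : ℝ) :
    HasSum (fun j => (bernsteinCoeff W j : ℂ) *
      (f (t + bernsteinNode W j) - f (t + -bernsteinNode W j)))
      (∫ ξ : ℝ, Complex.I * (2 * Real.pi * ξ : ℝ) *
        (Complex.exp (Complex.I * ((2 * Real.pi * ξ : ℝ) * t)) * g ξ)) := by
  have hmain := hasSum_integral_of_dominated_convergence (μ := (volume : Measure ℝ))
    (F := fun j (ξ : ℝ) => (bernsteinCoeff W j : ℂ) *
      (Complex.exp (Complex.I * ((2 * Real.pi * ξ : ℝ) * (t + bernsteinNode W j : ℝ))) * g ξ -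
        Complex.exp (Complex.I * ((2 * Real.pi * ξ : ℝ) * (t + -bernsteinNode W j : ℝ))) * g ξ))
    (f := fun ξ : ℝ => Complex.I * (2 * Real.pi * ξ : ℝ) *
        (Complex.exp (Complex.I * ((2 * Real.pi * ξ : ℝ) * t)) * g ξ))
    (fun j ξ => |bernsteinCoeff W j| * 2 * ‖g ξ‖) ?_ ?_ ?_ ?_ ?_
  · convert! hmain using 2 with j
    rw [integral_const_mul, integral_sub (integrable_exp_mul hg _) (integrable_exp_mul hg _),
      hfg, hfg]
  · intro j
    exact (((integrable_exp_mul hg _).sub (integrable_exp_mul hg _)).const_mul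
      _).aestronglyMeasurable
  · refine fun j => .of_forall fun ξ => ?_
    rw [norm_mul, Complex.norm_real, Real.norm_eq_abs, mul_assoc |bernsteinCoeff W j|,
      two_mul ‖g ξ‖]
    refine mul_le_mul_of_nonneg_left ?_ (abs_nonneg _)
    refine (norm_sub_le _ _).trans_eq ?_
    rw [norm_mul, norm_mul, norm_exp_I_mul, norm_exp_I_mul, one_mul]
  · exact .of_forall fun ξ => ((hasSum_abs_bernsteinCoeff hW).mul_right _).summable
  · simp_rw [((hasSum_abs_bernsteinCoeff hW).mul_right _).tsum_eq]
    exact hg.norm.const_mul W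
  · filter_upwards [hg0] with ξ h
    by_cases hξ : W < |2 * Real.pi * ξ|
    · simp [h hξ]
    · convert! (hasSum_bernstein hW (not_lt.1 hξ)).mul_right
        (Complex.exp (Complex.I * ((2 * Real.pi * ξ : ℝ) * t)) * g ξ) using 2 with j
      have : ∀ s : ℝ, Complex.exp (Complex.I * ((2 * Real.pi * ξ : ℝ) * (t + s : ℝ))) =
          Complex.exp (Complex.I * ((2 * Real.pi * ξ : ℝ) * s)) *
            Complex.exp (Complex.I * ((2 * Real.pi * ξ : ℝ) * t)) := by
        intro s
        rw [← Complex.exp_add]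
        congr 1
        push_cast
        ring
      rw [this, this]
      push_cast
      ring

/-- Bernstein's inequality, in the form of a bound on differences. -/
theorem IsBandlimited.norm_fwdDiff_le {W T M : ℝ} (hW : 0 < W) (hT : 0 ≤ T) {f : ℝ → ℂ}
    (hf : IsBandlimited W f) (hM : ∀ t, ‖f t‖ ≤ M) (t : ℝ) :
    ‖_root_.fwdDiff T f t‖ ≤ T * W * M := by
  obtain ⟨g, hg, hg0, hfg⟩ := hf
  have hd := IsBandlimited.hasDerivAt hg hg0 hfg
  have hb : ∀ s : ℝ, ‖∫ ξ : ℝ, Complex.I * (2 * Real.pi * ξ : ℝ) *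
      (Complex.exp (Complex.I * ((2 * Real.pi * ξ : ℝ) * s)) * g ξ)‖ ≤ W * M := by
    intro s
    have hs := IsBandlimited.hasSum_deriv hW hg hg0 hfg s
    rw [← hs.tsum_eq]
    refine tsum_of_norm_bounded ((hasSum_abs_bernsteinCoeff hW).mul_right M) fun j => ?_
    rw [norm_mul, Complex.norm_real, Real.norm_eq_abs, mul_assoc |bernsteinCoeff W j|,
      two_mul M]
    gcongr
    exact (norm_sub_le _ _).trans (add_le_add (hM _) (hM _))
  -- Mean value inequality on `[t, t + T]` with the derivative bound `W * M`.
  have := norm_image_sub_le_of_norm_deriv_le_segment' (a := t) (b := t + T) (C := W * M)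
    (fun s _ => (hd s).hasDerivWithinAt) (fun s _ => hb s) (t + T) ⟨by linarith, le_rfl⟩
  rw [_root_.fwdDiff]
  refine this.trans_eq ?_
  ring

theorem IsBandlimited.norm_iterate_fwdDiff_le {W T M : ℝ} (hW : 0 < W) (hT : 0 ≤ T) {f : ℝ → ℂ}
    (hf : IsBandlimited W f) (hM : ∀ t, ‖f t‖ ≤ M) (n : ℕ) (t : ℝ) :
    ‖(_root_.fwdDiff T)^[n] f t‖ ≤ (T * W) ^ n * M := by
  have : IsBandlimited W ((_root_.fwdDiff T)^[n] f) ∧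
      ∀ t, ‖(_root_.fwdDiff T)^[n] f t‖ ≤ (T * W) ^ n * M := by
    induction n with
    | zero => simpa using ⟨hf, hM⟩
    | succ n ih =>
      rw [Function.iterate_succ_apply']
      refine ⟨ih.1.fwdDiff T, fun t => ?_⟩
      rw [pow_succ', mul_assoc]
      exact ih.1.norm_fwdDiff_le hW hT ih.2 t
  exact this.2 t

/-! ### Paley-Wiener signals as inverse Fourier integrals -/

theorem continuous_fourierInv_of_integrable {g : ℝ → ℂ} (hg : Integrable g) :
    Continuous (𝓕⁻ g) := by
  rw [Real.fourierInv_eq_fourier_comp_neg]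
  exact VectorFourier.fourierIntegral_continuous Real.continuous_fourierChar
    (by fun_prop) hg.comp_neg

/-- An `L²` function whose Fourier transform is integrable is a.e. equal to the inverse Fourier
integral of its transform. -/
theorem ae_eq_fourierInv_of_integrable (f : Lp ℂ 2 (volume : Measure ℝ))
    (hg : Integrable (𝓕 f : Lp ℂ 2 (volume : Measure ℝ))) :
    (f : ℝ → ℂ) =ᵐ[volume] 𝓕⁻ ((𝓕 f : Lp ℂ 2 (volume : Measure ℝ)) : ℝ → ℂ) := by
  set G : Lp ℂ 2 (volume : Measure ℝ) := 𝓕 f with hG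
  have hcont := continuous_fourierInv_of_integrable hg
  refine ae_eq_of_integral_contDiff_smul_eq
    ((Lp.memLp f).locallyIntegrable (by norm_num)) hcont.locallyIntegrable fun φ hφ hφc => ?_
  have h1 : HasCompactSupport (fun t => (φ t : ℂ)) := hφc.comp_left (g := ((↑) : ℝ → ℂ)) rfl
  have h2 : ContDiff ℝ (⊤ : ℕ∞) (fun t => (φ t : ℂ)) := Complex.ofRealCLM.contDiff.comp hφ
  let ψ : SchwartzMap ℝ ℂ := h1.toSchwartzMap h2
  have hψ : ∀ t, ψ t = (φ t : ℂ) := fun t => rfl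
  -- Both sides are tested against smooth compactly supported functions. Inversion in `L²`, read in
  -- tempered distributions, puts the transform on the test function; the multiplication formula
  -- then moves it onto `G`.
  have e1 := congrArg (fun u => u ψ) (Lp.fourierInv_toTemperedDistribution_eq G)
  have e2 : 𝓕⁻ G = f := by rw [hG, FourierTransform.fourierInv_fourier_eq]
  rw [e2] at e1
  simp only [TemperedDistribution.fourierInv_apply, Lp.toTemperedDistribution_apply] at e1
  calc ∫ t, φ t • (f : ℝ → ℂ) t = ∫ t, ψ t • (f : ℝ → ℂ) t := by
        simp only [hψ, Complex.real_smul, smul_eq_mul]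
    _ = ∫ ξ, (𝓕⁻ ψ) ξ • (G : ℝ → ℂ) ξ := e1.symm
    _ = ∫ ξ, (𝓕⁻ (ψ : ℝ → ℂ)) ξ • (G : ℝ → ℂ) ξ := by
        rw [SchwartzMap.fourierInv_coe]
    _ = ∫ t, ψ t • (𝓕⁻ (G : ℝ → ℂ)) t := by
        have hflip : (-innerₗ ℝ).flip = -innerₗ ℝ := by
          ext
          simp
        have := VectorFourier.integral_fourierIntegral_smul_eq_flip (L := -innerₗ ℝ)
          (μ := volume) (ν := volume)
          Real.continuous_fourierChar (continuous_inner (𝕜 := ℝ) (E := ℝ)).neg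
          (ψ.integrable (μ := volume)) hg
        rw [hflip] at this
        exact this
    _ = _ := by simp only [hψ, Complex.real_smul, smul_eq_mul]

/-- An `L²` transform vanishing off a set of finite measure is integrable. The signal then equals an
inverse Fourier integral almost everywhere, hence everywhere, because both are continuous. -/
theorem PaleyWiener.isBandlimited {W : ℝ} {x : ℝ → ℝ} (hx : x ∈ PaleyWiener W) :
    IsBandlimited W fun t => (x t : ℂ) := by
  obtain ⟨hcont, hmem, hsupp⟩ := hx
  set G : Lp ℂ 2 (volume : Measure ℝ) := 𝓕 (hmem.toLp (fun t => (x t : ℂ))) with hG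
  set S : Set ℝ := {ξ | |2 * Real.pi * ξ| ≤ W} with hS
  have hSm : MeasurableSet S := measurableSet_le (by fun_prop) measurable_const
  have hSfin : volume S ≠ ⊤ := by
    refine ((measure_mono (t := Set.Icc (-(W / (2 * Real.pi))) (W / (2 * Real.pi)))
      fun ξ hξ => ?_).trans_lt measure_Icc_lt_top).ne
    have hξ' : |2 * Real.pi * ξ| ≤ W := hξ
    rw [abs_mul, abs_of_pos Real.two_pi_pos] at hξ'
    exact abs_le.1 ((le_div_iff₀' Real.two_pi_pos).2 hξ')
  have hind : S.indicator (G : ℝ → ℂ) =ᵐ[volume] G := by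
    filter_upwards [hsupp] with ξ h
    by_cases hξ : ξ ∈ S
    · simp [hξ]
    · rw [Set.indicator_of_notMem hξ, h (not_le.1 hξ)]
  have hGint : Integrable G := by
    have : IntegrableOn (G : ℝ → ℂ) S := by
      have : IsFiniteMeasure (volume.restrict S) := ⟨by simpa using hSfin.lt_top⟩
      exact ((Lp.memLp G).restrict S).integrable (by norm_num)
    exact (this.integrable_indicator hSm).congr hind
  refine ⟨G, hGint, hsupp, fun t => ?_⟩
  have hae := hmem.coeFn_toLp.symm.trans (ae_eq_fourierInv_of_integrable _ hGint)
  have heq := (Complex.continuous_ofReal.comp hcont).ae_eq_iff_eq volume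
    (continuous_fourierInv_of_integrable hGint) |>.1 hae
  have := congrFun heq t
  simp only [Function.comp_apply] at this
  refine (this.trans (Real.fourierInv_eq' _ _)).trans ?_
  refine integral_congr_ae (.of_forall fun ξ => ?_)
  simp only [smul_eq_mul, RCLike.inner_apply, conj_trivial]
  congr 2
  push_cast
  ring

theorem PaleyWiener.abs_iterate_fwdDiff_le {W T M : ℝ} (hW : 0 < W) (hT : 0 ≤ T) {x : ℝ → ℝ}
    (hx : x ∈ PaleyWiener W) (hM : ∀ t, |x t| ≤ M) (n : ℕ) (k : ℤ) :
    |(fwdDiff (1 : ℤ))^[n] (fun k : ℤ => x (k * T)) k| ≤ (T * W) ^ n * M := by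
  have h := (PaleyWiener.isBandlimited hx).norm_iterate_fwdDiff_le hW hT (M := M)
    (fun t => by simpa using hM t) n (k * T)
  have key : ∀ (n : ℕ) (k : ℤ), (((fwdDiff (1 : ℤ))^[n] (fun k : ℤ => x (k * T)) k : ℝ) : ℂ) =
      (fwdDiff T)^[n] (fun t => (x t : ℂ)) (k * T) := by
    intro n
    induction n with
    | zero => simp
    | succ n ih =>
      intro k
      rw [Function.iterate_succ_apply', Function.iterate_succ_apply', fwdDiff, fwdDiff,
        Complex.ofReal_sub, ih, ih]
      push_cast
      ring_nf
  rwa [← key, Complex.norm_real] at h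

/-! ### Iterated differences -/

/-- An `n`-th difference at `k` sees only `k, …, k + n`. This locality allows a finite `I`, outside
which `y` is uncontrolled. -/
theorem iterate_fwdDiff_congr {f g : ℤ → ℝ} (n : ℕ) (k : ℤ)
    (h : ∀ j, k ≤ j → j ≤ k + n → f j = g j) :
    (fwdDiff (1 : ℤ))^[n] f k = (fwdDiff (1 : ℤ))^[n] g k := by
  induction n generalizing k with
  | zero => exact h k le_rfl (by simp)
  | succ n ih =>
    rw [Function.iterate_succ_apply', Function.iterate_succ_apply', fwdDiff, fwdDiff,
      ih k fun j h1 h2 => h j h1 (by push_cast; omega),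
      ih (k + 1) fun j h1 h2 => h j (by omega) (by push_cast; omega)]

theorem iterate_fwdDiff_sub (f g : ℤ → ℝ) (n : ℕ) (k : ℤ) :
    (fwdDiff (1 : ℤ))^[n] (fun j => f j - g j) k =
      (fwdDiff (1 : ℤ))^[n] f k - (fwdDiff (1 : ℤ))^[n] g k := by
  induction n generalizing k with
  | zero => rfl
  | succ n ih =>
    rw [Function.iterate_succ_apply', Function.iterate_succ_apply', Function.iterate_succ_apply',
      fwdDiff, fwdDiff, fwdDiff, ih, ih]
    ring

theorem iterate_fwdDiff_lattice (c : ℝ) (f : ℤ → ℤ) (n : ℕ) (k : ℤ) :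
    ∃ i : ℤ, (fwdDiff (1 : ℤ))^[n] (fun j => c * f j) k = c * i := by
  induction n generalizing k with
  | zero => exact ⟨f k, rfl⟩
  | succ n ih =>
    obtain ⟨i, hi⟩ := ih k
    obtain ⟨i', hi'⟩ := ih (k + 1)
    refine ⟨i' - i, ?_⟩
    rw [Function.iterate_succ_apply', fwdDiff, hi, hi']
    push_cast
    ring

theorem abs_iterate_fwdDiff_le {f : ℤ → ℝ} {M : ℝ} (n : ℕ) (k : ℤ)
    (h : ∀ j, k ≤ j → j ≤ k + n → |f j| ≤ M) :
    |(fwdDiff (1 : ℤ))^[n] f k| ≤ 2 ^ n * M := by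
  induction n generalizing k with
  | zero => simpa using h k le_rfl (by simp)
  | succ n ih =>
    rw [Function.iterate_succ_apply', fwdDiff]
    have h1 := ih k fun j h1 h2 => h j h1 (by push_cast; omega)
    have h2 := ih (k + 1) fun j h1 h2 => h j (by omega) (by push_cast; omega)
    refine (abs_sub _ _).trans ((add_le_add h2 h1).trans_eq ?_)
    ring

/-! ### Folding, rounding and summation -/

theorem abs_fold_le {lam : ℝ} (hlam : 0 < lam) (t : ℝ) : |fold lam t| ≤ lam := by
  have h1 := Int.floor_le (t / (2 * lam) + 1 / 2)
  have h2 := Int.lt_floor_add_one (t / (2 * lam) + 1 / 2)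
  have ht : t = 2 * lam * (t / (2 * lam)) := by field_simp
  rw [fold, abs_le]
  constructor <;> nlinarith

/-- Folding has period `2 * lam` and fixes `(-lam, lam)`, so a small quantity survives any lattice
shift. -/
theorem fold_sub_lattice {lam g : ℝ} (hlam : 0 < lam) (hg : |g| < lam) (n : ℤ) :
    fold lam (g - 2 * lam * n) = g := by
  obtain ⟨h1, h2⟩ := abs_lt.1 hg
  have : ⌊(g - 2 * lam * n) / (2 * lam) + 1 / 2⌋ = -n := by
    rw [show (g - 2 * lam * n) / (2 * lam) + 1 / 2 = g / (2 * lam) + 1 / 2 - n by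
      field_simp
      ring, Int.floor_sub_intCast, sub_eq_neg_self, Int.floor_eq_zero_iff]
    constructor
    · have : -(1 / 2) ≤ g / (2 * lam) := by rw [le_div_iff₀ (by positivity)]; linarith
      linarith
    · have : g / (2 * lam) < 1 / 2 := by rw [div_lt_iff₀ (by positivity)]; linarith
      linarith
  rw [fold, this]
  push_cast
  ring

theorem roundLattice_lattice {lam : ℝ} (hlam : 0 < lam) (n : ℤ) :
    roundLattice lam (2 * lam * n) = 2 * lam * n := by
  have h1 : 2 * lam * n / lam = ((2 * n : ℤ) : ℝ) := by
    push_cast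
    field_simp
  have h2 : ((2 * n : ℤ) : ℝ) / 2 = (n : ℝ) := by
    push_cast
    ring
  rw [roundLattice, h1, Int.floor_intCast, h2, Int.ceil_intCast]

theorem sum_Ico_eq_sub {s f : ℤ → ℝ} {a b : ℤ} (hab : a ≤ b)
    (h : ∀ j, a ≤ j → j < b → s j = f (j + 1) - f j) :
    ∑ j ∈ Finset.Ico a b, s j = f b - f a := by
  induction b, hab using Int.leInduction with
  | base => simp
  | succ b hab ih =>
    have : Finset.Ico a (b + 1) = insert b (Finset.Ico a b) := by
      ext j
      simp only [Finset.mem_Ico, Finset.mem_insert]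
      omega
    rw [this, Finset.sum_insert (by simp), ih fun j h1 h2 => h j h1 (by omega),
      h b hab (by omega)]
    ring

theorem invDiff_eq_sub {s f : ℤ → ℝ} {k₀ k : ℤ}
    (h : ∀ j, min k₀ k ≤ j → j < max k₀ k → s j = f (j + 1) - f j) :
    invDiff k₀ s k = f k - f k₀ := by
  rw [invDiff]
  rcases le_total k₀ k with hk | hk
  · rw [min_eq_left hk, max_eq_right hk] at h
    rw [sum_Ico_eq_sub hk h, Finset.Ico_eq_empty (by omega), Finset.sum_empty, sub_zero]
  · rw [min_eq_right hk, max_eq_left hk] at h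
    rw [sum_Ico_eq_sub hk h, Finset.Ico_eq_empty (by omega), Finset.sum_empty]
    ring

/-- A difference of order `n + 1` is known at `j` only when `j` and `j + n + 1` both lie in `I`. One
summation lowers the order, and the known range grows by one step accordingly. -/
theorem invDiff_eq_sub_of_mem {I : Set ℤ} (hI : I.OrdConnected) {s f : ℤ → ℝ} {k₀ k : ℤ} {n : ℕ}
    (hk₀ : k₀ ∈ I) (hk₀n : k₀ + n ∈ I) (hk : k ∈ I) (hkn : k + n ∈ I)
    (hs : ∀ j ∈ I, j + n + 1 ∈ I → s j = f (j + 1) - f j) :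
    invDiff k₀ s k = f k - f k₀ := by
  refine invDiff_eq_sub fun j h1 h2 => hs j ?_ ?_
  · rcases le_total k₀ k with h | h
    · exact hI.out hk₀ hk ⟨by omega, by omega⟩
    · exact hI.out hk hk₀ ⟨by omega, by omega⟩
  · rcases le_total k₀ k with h | h
    · exact hI.out hk₀ hkn ⟨by omega, by omega⟩
    · exact hI.out hk hk₀n ⟨by omega, by omega⟩

/-! ### The reconstruction loop -/

/-- Here `s` is the second difference of `f`, and its antidifference misses the constant `Δf(k₀) = 2
* lam * n`. Integrating again turns this constant into a drift `J * 2 * lam * n = 12 * β * n` at `k₀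
+ J`. The change of `f` itself is below half the spacing `12 * β`, so rounding returns `n`. All
values then lie on the lattice, where `roundLattice` acts as the identity. -/
theorem integrateStep_eq {lam β : ℝ} (hlam : 0 < lam) (hβ : 0 < β)
    (hJ : lam * lookAhead lam β = 6 * β) {I : Set ℤ} (hI : I.OrdConnected) {k₀ : ℤ} {q : ℕ}
    (hk₀ : Set.Icc k₀ (k₀ + lookAhead lam β + q) ⊆ I) {s f : ℤ → ℝ}
    (hs : ∀ j ∈ I, j + (q + 1 : ℕ) + 1 ∈ I →
      s j = fwdDiff (1 : ℤ) f (j + 1) - fwdDiff (1 : ℤ) f j)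
    (hlat : ∀ k, ∃ i : ℤ, fwdDiff (1 : ℤ) f k = 2 * lam * i)
    (hbd : |f (k₀ + lookAhead lam β) - f k₀| < 6 * β)
    {k : ℤ} (hk : k ∈ I) (hkq : k + (q + 1 : ℕ) ∈ I) :
    integrateStep lam β k₀ s k = fwdDiff (1 : ℤ) f k := by
  set J := lookAhead lam β with hJdef
  -- Positivity of `J` puts `k₀ + q + 1` inside the window.
  have hJpos : 1 ≤ J := by
    by_contra! h
    have : J = 0 := by omega
    rw [this] at hJ
    norm_num at hJ
    linarith
  have hk₀I : k₀ ∈ I := hk₀ ⟨le_rfl, by omega⟩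
  have hk₀q : k₀ + (q + 1 : ℕ) ∈ I := hk₀ ⟨by omega, by push_cast; omega⟩
  have h1 : ∀ j ∈ I, j + (q + 1 : ℕ) ∈ I →
      invDiff k₀ s j = fwdDiff (1 : ℤ) f j - fwdDiff (1 : ℤ) f k₀ :=
    fun j hj hjq => invDiff_eq_sub_of_mem hI hk₀I hk₀q hj hjq hs
  obtain ⟨n, hn⟩ := hlat k₀
  have h2 : invDiff k₀ (invDiff k₀ s) (k₀ + J) =
      f (k₀ + J) - f k₀ - J * (2 * lam * n) := by
    -- Subtracting from `f` the line of slope `Δf(k₀)` gives a function whose difference is the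
    -- first antidifference of `s`.
    rw [invDiff_eq_sub (f := fun j => f j - ((j : ℝ) - k₀) * (2 * lam * n))]
    · push_cast
      ring
    · intro j hj1 hj2
      rw [h1 j (hk₀ ⟨by omega, by omega⟩) (hk₀ ⟨by omega, by push_cast; omega⟩), hn, fwdDiff]
      push_cast
      ring
  have h3 : invDiff k₀ (invDiff k₀ s) k₀ = 0 := by simp [invDiff]
  have hκ : kappa lam β k₀ s = n := by
    obtain ⟨hb1, hb2⟩ := abs_lt.1 hbd
    rw [kappa, ← hJdef, h2, h3]
    have : (0 - (f (k₀ + J) - f k₀ - J * (2 * lam * n))) / (12 * β) + 1 / 2 =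
        (1 / 2 - (f (k₀ + J) - f k₀) / (12 * β)) + n := by
      field_simp
      linear_combination 4 * (n : ℝ) * hJ
    rw [this, Int.floor_add_intCast, add_eq_right, Int.floor_eq_zero_iff]
    have e1 : (f (k₀ + J) - f k₀) / (12 * β) < 1 / 2 := by
      rw [div_lt_iff₀ (by positivity)]; linarith
    have e2 : -(1 / 2) < (f (k₀ + J) - f k₀) / (12 * β) := by
      rw [lt_div_iff₀ (by positivity)]; linarith
    constructor <;> linarith
  obtain ⟨i, hi⟩ := hlat k
  rw [integrateStep, hκ, h1 k hk hkq, hi, hn,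
    show 2 * lam * (i : ℝ) - 2 * lam * n = 2 * lam * ((i - n : ℤ) : ℝ) by push_cast; ring,
    roundLattice_lattice hlam]
  push_cast
  ring

/-- The loop invariant is that `p` passes produce `Δ^(N-p) ε` with `ε = 2 * lam * n`, wherever the
stencil of that difference fits in `I`. -/
theorem reconstruct_eq {lam β T W : ℝ} (hlam : 0 < lam) (hβ : 0 < β)
    (hJ : lam * lookAhead lam β = 6 * β) {I : Set ℤ} (hI : I.OrdConnected) {k₀ : ℤ}
    (hN : 1 ≤ diffOrder lam β T W)
    (hk₀ : Set.Ico k₀ (k₀ + diffOrder lam β T W + lookAhead lam β) ⊆ I)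
    {y γ : ℤ → ℝ} {n : ℤ → ℤ} (hy : ∀ k ∈ I, y k = γ k - 2 * lam * n k)
    (hγ : ∀ k ∈ I, k + diffOrder lam β T W ∈ I →
      |(fwdDiff (1 : ℤ))^[diffOrder lam β T W] γ k| < lam)
    (hn : ∀ q, q + 2 ≤ diffOrder lam β T W → ∀ k,
      |(fwdDiff (1 : ℤ))^[q] (fun j => 2 * lam * (n j : ℝ)) k| < 3 * β)
    {k : ℤ} (hk : k ∈ I) :
    reconstruct lam β T W k₀ y k = γ k - 2 * lam * n k₀ := by
  rw [reconstruct]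
  set N := diffOrder lam β T W with hNdef
  set J := lookAhead lam β with hJdef
  set ε : ℤ → ℝ := fun j => 2 * lam * (n j : ℝ) with hε
  set d : ℤ → ℝ := (fwdDiff (1 : ℤ))^[N] y with hd
  have hk₀I : k₀ ∈ I := hk₀ ⟨le_rfl, by omega⟩
  -- The order `N - p` is written `q + 1`, so the pass integrating to this order uses `f = Δ^q ε`,
  -- with `q + 2 ≤ N`.
  have loop : ∀ p q, p + q + 1 = N → ∀ k ∈ I, k + (q + 1 : ℕ) ∈ I →
      (integrateStep lam β k₀)^[p] (fun j => fold lam (d j) - d j) k =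
        (fwdDiff (1 : ℤ))^[q + 1] ε k := by
    intro p
    induction p with
    | zero =>
      intro q hq k hk hkq
      have hqN : q + 1 = N := by omega
      rw [hqN] at hkq ⊢
      have hdk : d k = (fwdDiff (1 : ℤ))^[N] γ k - (fwdDiff (1 : ℤ))^[N] ε k := by
        rw [hd, ← iterate_fwdDiff_sub]
        exact iterate_fwdDiff_congr N k fun j h1 h2 => hy j (hI.out hk hkq ⟨h1, h2⟩)
      obtain ⟨i, hi⟩ := iterate_fwdDiff_lattice (2 * lam) n N k
      simp only [Function.iterate_zero, id_eq]
      rw [hdk, hε, hi, fold_sub_lattice hlam (hγ k hk hkq)]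
      ring
    | succ p ih =>
      intro q hq k hk hkq
      rw [Function.iterate_succ_apply', Function.iterate_succ_apply']
      refine integrateStep_eq hlam hβ hJ hI (q := q) (fun j hj => hk₀ ⟨hj.1, ?_⟩) ?_ ?_ ?_ hk hkq
      · have := hj.2
        omega
      · intro j hj hjq
        rw [ih (q + 1) (by omega) j hj (by push_cast at hjq ⊢; rwa [← add_assoc]),
          Function.iterate_succ_apply', Function.iterate_succ_apply']
        rfl
      · intro k
        rw [← Function.iterate_succ_apply' (fwdDiff (1 : ℤ))]
        exact iterate_fwdDiff_lattice (2 * lam) n (q + 1) k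
      · refine (abs_sub _ _).trans_lt ?_
        have h1 := hn q (by omega) (k₀ + J)
        have h2 := hn q (by omega) k₀
        linarith
  have hfin : invDiff k₀ ((integrateStep lam β k₀)^[N - 1] fun j => fold lam (d j) - d j) k =
      ε k - ε k₀ := by
    refine invDiff_eq_sub_of_mem hI (n := 0) hk₀I (by simpa using hk₀I) hk (by simpa using hk) ?_
    intro j hj hj'
    rw [loop (N - 1) 0 (by omega) j hj (by simpa using hj')]
    rfl
  rw [hfin, hy k hk, hε]
  ring

/-! ### The order of differences -/

/-- For `β = 2 * lam * b` the quotient is the integer `12 * b`, so the floor loses nothing. -/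
theorem mul_lookAhead {lam β : ℝ} (hlam : 0 < lam) (hβ : 0 < β)
    (hβ_lattice : ∃ b : ℤ, β = 2 * lam * b) : lam * lookAhead lam β = 6 * β := by
  obtain ⟨b, rfl⟩ := hβ_lattice
  have hb : 0 < b := by
    have : (0 : ℝ) < b := pos_of_mul_pos_right hβ (by positivity)
    exact_mod_cast this
  lift b to ℕ using hb.le
  have : 6 * (2 * lam * ((b : ℤ) : ℝ)) / lam = ((12 * b : ℕ) : ℝ) := by
    push_cast
    field_simp
    ring
  rw [lookAhead, this, Nat.floor_natCast]
  push_cast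
  ring

theorem two_mul_le_of_lattice {lam β : ℝ} (hlam : 0 < lam) (hβ : 0 < β)
    (hβ_lattice : ∃ b : ℤ, β = 2 * lam * b) : 2 * lam ≤ β := by
  obtain ⟨b, rfl⟩ := hβ_lattice
  have hb : 0 < b := by
    have : (0 : ℝ) < b := pos_of_mul_pos_right hβ (by positivity)
    exact_mod_cast this
  have : (1 : ℝ) ≤ b := by exact_mod_cast hb
  nlinarith

theorem log_div_pos_of_two_mul_le {lam β : ℝ} (hlam : 0 < lam) (h : 2 * lam ≤ β) :
    0 < Real.log (β / lam) :=
  Real.log_pos (by rw [lt_div_iff₀ hlam]; linarith)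

/-- The rate `T W e` lies below `2 ^ (-h)`. -/
theorem log_rate_le {T W : ℝ} (hW : 0 < W) (hT : 0 < T) {h : ℕ}
    (hTh : T ≤ 1 / (2 ^ h * W * Real.exp 1)) :
    Real.log (T * W * Real.exp 1) ≤ -(h * Real.log 2) := by
  have : T * W * Real.exp 1 ≤ (2 ^ h)⁻¹ := by
    rw [le_div_iff₀ (by positivity)] at hTh
    rw [← one_div, le_div_iff₀ (by positivity)]
    linarith
  calc Real.log (T * W * Real.exp 1) ≤ Real.log ((2 ^ h)⁻¹) :=
        Real.log_le_log (by positivity) this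
    _ = -(h * Real.log 2) := by rw [Real.log_inv, Real.log_pow]

theorem one_le_diffOrder {lam β T W : ℝ} (hlam : 0 < lam) (hβ : 2 * lam ≤ β)
    (hlog : Real.log (T * W * Real.exp 1) < 0) : 1 ≤ diffOrder lam β T W := by
  have h := log_div_pos_of_two_mul_le hlam hβ
  rw [Real.log_div (by linarith) hlam.ne'] at h
  exact Nat.ceil_pos.2 (div_pos_of_neg_of_neg (by linarith) hlog)

theorem rate_pow_diffOrder_mul_le {lam β T W : ℝ} (hlam : 0 < lam) (hβ : 0 < β) (hW : 0 < W)
    (hT : 0 < T) (hlog : Real.log (T * W * Real.exp 1) < 0) :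
    (T * W * Real.exp 1) ^ diffOrder lam β T W * β ≤ lam := by
  have h := Nat.le_ceil ((Real.log lam - Real.log β) / Real.log (T * W * Real.exp 1))
  rw [div_le_iff_of_neg hlog] at h
  rw [← Real.log_le_log_iff (by positivity) hlam, Real.log_mul (by positivity) hβ.ne',
    Real.log_pow, diffOrder]
  linarith

/-- The ceiling overshoots by less than one. This upper bound on `N` limits the noise amplification
`2 ^ N`, while the lower bound supplies the decay of `Δ^N x`. -/
theorem diffOrder_sub_one_mul_lt {lam β T W : ℝ} (hlam : 0 < lam) (hβ : 2 * lam ≤ β)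
    (hlog : Real.log (T * W * Real.exp 1) < 0) :
    ((diffOrder lam β T W : ℝ) - 1) * -Real.log (T * W * Real.exp 1) < Real.log (β / lam) := by
  have h := log_div_pos_of_two_mul_le hlam hβ
  rw [Real.log_div (by linarith) hlam.ne'] at h ⊢
  have h' : (diffOrder lam β T W : ℝ) <
      (Real.log lam - Real.log β) / Real.log (T * W * Real.exp 1) + 1 :=
    Nat.ceil_lt_add_one (div_pos_of_neg_of_neg (by linarith) hlog).le
  have h2 := mul_lt_mul_of_pos_right (sub_lt_iff_lt_add.2 h') (neg_pos.2 hlog)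
  rwa [mul_neg _ (Real.log (T * W * Real.exp 1)), mul_neg _ (Real.log (T * W * Real.exp 1)),
    div_mul_cancel₀ _ hlog.ne, neg_sub, ← mul_neg] at h2

theorem two_pow_lt_of_mul_log_lt {n : ℕ} {a : ℝ} (ha : 0 < a)
    (h : n * Real.log 2 < Real.log a) : (2 : ℝ) ^ n < a := by
  rwa [← Real.log_lt_log_iff (by positivity) ha, Real.log_pow]

theorem diffOrder_sub_one_mul_log_two_lt {lam β T W : ℝ} (hlam : 0 < lam) (hβ : 2 * lam ≤ β)
    (hW : 0 < W) (hT : 0 < T) {h : ℕ} (h1 : 1 ≤ h) (hTh : T ≤ 1 / (2 ^ h * W * Real.exp 1)) :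
    ((diffOrder lam β T W : ℝ) - 1) * (h * Real.log 2) < Real.log (β / lam) := by
  have hlog := log_rate_le hW hT hTh
  have h2 : (1 : ℝ) ≤ h := by exact_mod_cast h1
  have hl2 : 0 < (h : ℝ) * Real.log 2 := mul_pos (by linarith) (Real.log_pos one_lt_two)
  have hneg : Real.log (T * W * Real.exp 1) < 0 := by linarith
  have hN : (1 : ℝ) ≤ diffOrder lam β T W := by
    exact_mod_cast one_le_diffOrder hlam hβ hneg
  refine lt_of_le_of_lt ?_ (diffOrder_sub_one_mul_lt hlam hβ hneg)
  exact mul_le_mul_of_nonneg_left (by linarith) (by linarith)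

/-- Differences of order below `N - 1` amplify the modulo samples to less than `β`. -/
theorem two_pow_mul_lt_of_add_two_le {lam β T W : ℝ} (hlam : 0 < lam) (hβ : 2 * lam ≤ β)
    (hW : 0 < W) (hT : 0 < T) {h : ℕ} (h1 : 1 ≤ h) (hTh : T ≤ 1 / (2 ^ h * W * Real.exp 1))
    {q : ℕ} (hq : q + 2 ≤ diffOrder lam β T W) : 2 ^ q * lam < β := by
  have hmain := diffOrder_sub_one_mul_log_two_lt hlam hβ hW hT h1 hTh
  have h2 : (1 : ℝ) ≤ h := by exact_mod_cast h1
  have hl2 : 0 < Real.log 2 := Real.log_pos one_lt_two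
  have hq' : (q : ℝ) + 2 ≤ diffOrder lam β T W := by exact_mod_cast hq
  have hqh : (q : ℝ) * Real.log 2 < Real.log (β / lam) := by
    refine lt_of_le_of_lt ?_ hmain
    refine mul_le_mul (by linarith) (le_mul_of_one_le_left hl2.le h2) hl2.le ?_
    linarith [(Nat.cast_nonneg q : (0 : ℝ) ≤ q)]
  exact (lt_div_iff₀ hlam).1 (two_pow_lt_of_mul_log_lt (div_pos (by linarith) hlam) hqh)

/-- Differences of order `N` amplify the error to less than `lam / 2`. -/
theorem two_pow_diffOrder_mul_lt {lam β T W M ζ : ℝ} (hlam : 0 < lam) (hβ : 2 * lam ≤ β)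
    (hW : 0 < W) (hT : 0 < T) {h : ℕ} (h1 : 1 ≤ h) (hTh : T ≤ 1 / (2 ^ h * W * Real.exp 1))
    (hM : 0 ≤ M) (hζ : 1 < ζ) (hMζ : 4 * ζ * M ≤ lam)
    (hh : Real.log (2 * β / lam) / Real.log (lam / (4 * M)) ≤ h) :
    2 ^ diffOrder lam β T W * M < lam / 2 := by
  rcases hM.eq_or_lt with rfl | hM
  · simpa using hlam
  have hmain := diffOrder_sub_one_mul_log_two_lt hlam hβ hW hT h1 hTh
  have h2 : (1 : ℝ) ≤ h := by exact_mod_cast h1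
  -- The margin `ζ > 1` makes this logarithm positive, so the bound on `h` can be cleared of its
  -- denominator.
  have hA : 0 < Real.log (lam / (4 * M)) := by
    refine Real.log_pos ?_
    rw [lt_div_iff₀ (by positivity)]
    nlinarith
  rw [div_le_iff₀ hA, mul_div_assoc, Real.log_mul two_ne_zero
    (div_pos (by linarith : 0 < β) hlam).ne'] at hh
  have hl2 : 0 < Real.log 2 := Real.log_pos one_lt_two
  have hlog : Real.log (T * W * Real.exp 1) < 0 := by
    have := log_rate_le hW hT hTh
    nlinarith
  obtain ⟨n, hn⟩ := Nat.exists_eq_add_of_le' (one_le_diffOrder hlam hβ hlog)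
  rw [hn] at hmain ⊢
  push_cast at hmain
  -- With `n = N - 1`, the bounds `n * h * log 2 < log (β / lam)` and `log (2 * β / lam) ≤ h * log
  -- (lam / (4 * M))` combine, and `h` cancels. The remaining factor `2` in `2 ^ N` turns `lam / 4`
  -- into `lam / 2`.
  have hnA : (n : ℝ) * Real.log 2 < Real.log (lam / (4 * M)) := by
    refine lt_of_mul_lt_mul_left (a := (h : ℝ)) ?_ (by linarith)
    linarith
  have := (lt_div_iff₀ (by positivity)).1 (two_pow_lt_of_mul_log_lt (by positivity) hnA)
  rw [pow_succ]
  linarith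

/-- `N` is chosen for the rate `T * W * e`, while Bernstein's inequality gives `T * W`. The surplus
`e ^ N ≥ 2` frees half of the interval for the error. -/
theorem pow_diffOrder_mul_le {lam β T W : ℝ} (hlam : 0 < lam) (hβ : 2 * lam ≤ β) (hW : 0 < W)
    (hT : 0 < T) (hlog : Real.log (T * W * Real.exp 1) < 0) :
    (T * W) ^ diffOrder lam β T W * β ≤ lam / 2 := by
  have h := rate_pow_diffOrder_mul_le hlam (by linarith) hW hT hlog (β := β)
  have hN := one_le_diffOrder hlam hβ hlog
  have he : 2 ≤ Real.exp 1 ^ diffOrder lam β T W := by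
    have h2 : 2 ≤ Real.exp 1 := by linarith [Real.add_one_le_exp 1]
    exact h2.trans (le_self_pow₀ (by linarith) (by omega))
  have hpos : 0 ≤ (T * W) ^ diffOrder lam β T W * β := mul_nonneg (by positivity) (by linarith)
  rw [mul_pow] at h
  nlinarith

/-! ### Recovery from perturbed modulo samples -/

theorem abs_le_supNorm {I : Set ℤ} {e : ℤ → ℝ} (he : BddAbove (Set.range fun k : I => |e k|))
    {k : ℤ} (hk : k ∈ I) : |e k| ≤ supNorm I e :=
  le_ciSup he (⟨k, hk⟩ : I)

theorem supNorm_nonneg (I : Set ℤ) (e : ℤ → ℝ) : 0 ≤ supNorm I e :=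
  Real.iSup_nonneg fun _ => abs_nonneg _

/-- Recovery of the samples of a band-limited signal from perturbed modulo samples. -/
theorem exists_reconstruct_eq {W T lam β : ℝ} (hW : 0 < W) (hT : 0 < T) (hlam : 0 < lam)
    (hβ : 0 < β) (hβ_lattice : ∃ b : ℤ, β = 2 * lam * b)
    {x : ℝ → ℝ} (hx : x ∈ PaleyWiener W) (hxβ : ∀ t, |x t| ≤ β)
    {I : Set ℤ} (hI : I.OrdConnected) (k₀ : ℤ)
    (hk₀ : Set.Ico k₀ (k₀ + diffOrder lam β T W + lookAhead lam β) ⊆ I)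
    {y e : ℤ → ℝ} (he : ∀ k, e k = y k - moduloSample lam T x k)
    (hbdd : BddAbove (Set.range fun k : I => |e k|)) {h : ℕ} {ζ : ℝ} (h1 : 1 ≤ h) (hζ : 1 < ζ)
    (hTh : T ≤ 1 / (2 ^ h * W * Real.exp 1))
    (hh : Real.log (2 * β / lam) / Real.log (lam / (4 * supNorm I e)) ≤ h)
    (hMζ : 4 * ζ * supNorm I e ≤ lam) :
    ∃ c : ℤ, ∀ k ∈ I, reconstruct lam β T W k₀ y k = x (k * T) + e k + 2 * lam * c := by
  have hβ2 := two_mul_le_of_lattice hlam hβ hβ_lattice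
  have h2 : (1 : ℝ) ≤ h := by exact_mod_cast h1
  have hl2 : 0 < Real.log 2 := Real.log_pos one_lt_two
  have hrate := log_rate_le hW hT hTh
  have hlog : Real.log (T * W * Real.exp 1) < 0 := by nlinarith
  have hTW : T * W ≤ 1 := by
    have h3 : T * W * Real.exp 1 < 1 := (Real.log_neg_iff (by positivity)).1 hlog
    have h4 : 1 ≤ Real.exp 1 := Real.one_le_exp zero_le_one
    have h5 : 0 < T * W := by positivity
    nlinarith
  set n : ℤ → ℤ := fun k => ⌊x (k * T) / (2 * lam) + 1 / 2⌋ with hn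
  have hmod : ∀ k, 2 * lam * (n k : ℝ) = x (k * T) - fold lam (x (k * T)) := fun k => by
    rw [fold, hn]
    ring
  -- The lost constant is the folding number at the base point.
  refine ⟨-n k₀, fun k hk => ?_⟩
  rw [reconstruct_eq (γ := fun k => x (k * T) + e k) (n := n) hlam hβ
    (mul_lookAhead hlam hβ hβ_lattice) hI (one_le_diffOrder hlam hβ2 hlog) hk₀ ?_ ?_ ?_ hk]
  · push_cast
    ring
  · intro k _
    rw [he, hmod, moduloSample]
    ring
  · intro k hk hkN
    have hsplit := iterate_fwdDiff_sub (fun k : ℤ => x (k * T)) (fun k => -e k)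
      (diffOrder lam β T W) k
    simp only [sub_neg_eq_add] at hsplit
    rw [hsplit]
    have hx1 := (PaleyWiener.abs_iterate_fwdDiff_le hW hT.le hx hxβ (diffOrder lam β T W) k).trans
      (pow_diffOrder_mul_le hlam hβ2 hW hT hlog)
    have he1 : |(fwdDiff (1 : ℤ))^[diffOrder lam β T W] (fun k => -e k) k| < lam / 2 := by
      refine (abs_iterate_fwdDiff_le _ k fun j hj1 hj2 => ?_).trans_lt
        (two_pow_diffOrder_mul_lt hlam hβ2 hW hT h1 hTh (supNorm_nonneg I e) hζ hMζ hh)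
      rw [abs_neg]
      exact abs_le_supNorm hbdd (hI.out hk hkN ⟨hj1, hj2⟩)
    refine (abs_sub _ _).trans_lt ?_
    linarith
  -- Since `2 * lam * n` is the signal minus its folded samples, its `q`-th difference is below `β +
  -- β`: the signal part does not grow because `T * W ≤ 1`, and the folded part is at most `2 ^ q *
  -- lam < β`.
  · intro q hq k
    rw [funext hmod, iterate_fwdDiff_sub]
    refine (abs_sub _ _).trans_lt ?_
    have hx1 := PaleyWiener.abs_iterate_fwdDiff_le hW hT.le hx hxβ q k
    have hx2 : (T * W) ^ q * β ≤ β :=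
      mul_le_of_le_one_left hβ.le (pow_le_one₀ (by positivity) hTW)
    have hf := (abs_iterate_fwdDiff_le (f := fun k : ℤ => fold lam (x (k * T))) q k
      fun j _ _ => abs_fold_le hlam _).trans_lt
      (two_pow_mul_lt_of_add_two_le hlam hβ2 hW hT h1 hTh hq)
    linarith

end UNO

theorem theorem2
    -- the signal, and the known bound on its amplitude
    {W T lam β : ℝ} (hW : 0 < W) (hT : 0 < T) (hlam : 0 < lam)
    (hβ : 0 < β) (hβ_lattice : ∃ b : ℤ, β = 2 * lam * b)
    {x : ℝ → ℝ} (hx : x ∈ UNO.PaleyWiener W) (hxβ : ∀ t, |x t| ≤ β)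
    -- the sampled positions: consecutive integers, partitioned into finite blocks
    {I : Set ℤ} (hI : I.OrdConnected) {ι : Type*} (B : ι → Finset ℤ)
    (hB_disj : Pairwise fun a a' => Disjoint (B a) (B a')) (hB_union : ⋃ a, (B a : Set ℤ) = I)
    (k₀ : ℤ)
    (hk₀ : Set.Ico k₀ (k₀ + UNO.diffOrder lam β T W + UNO.lookAhead lam β) ⊆ I)
    -- random thresholds and random row selections
    {Ω' : Type*} [MeasurableSpace Ω'] (P : Measure Ω') [IsProbabilityMeasure P]
    {m : ℕ} (τ : Fin m → ℤ → Ω' → ℝ) (rows : (a : ι) → ℕ → Ω' → Fin m × (B a))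
    (hexp : UNO.IsExperiment P lam B τ rows)
    -- the modulo samples reconstructed by the algorithm from the one-bit samples, blockwise
    (v₀ : ℤ → ℝ) (imax : ℕ) (y : Ω' → ℤ → ℝ)
    (hy : ∀ ω a, ∀ k : B a, y ω k =
      UNO.oneBitRKA
        (fun l (j : B a) => UNO.oneBit (UNO.moduloSample lam T x) (fun l k => τ l k ω) l j)
        (fun l (j : B a) => τ l j ω) (fun i => rows a i ω) (fun j : B a => v₀ j) imax k)
    -- the reconstruction error
    (e : Ω' → ℤ → ℝ) (he : ∀ ω k, e ω k = y ω k - UNO.moduloSample lam T x k) :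
    ∀ ω : Ω', BddAbove (Set.range fun k : I => |e ω k|) →
      ∀ (h : ℕ) (ζ : ℝ), 1 ≤ h → 1 < ζ →
        T ≤ 1 / (2 ^ h * W * Real.exp 1) →
        (h : ℝ) ≥ Real.log (2 * β / lam) / Real.log (lam / (4 * UNO.supNorm I (e ω))) →
        lam ≥ 4 * ζ * UNO.supNorm I (e ω) →
        ∃ c : ℤ, ∀ k ∈ I,
          UNO.reconstruct lam β T W k₀ (y ω) k = x (k * T) + e ω k + 2 * lam * c := by
  intro ω hbdd h ζ h1 hζ hTh hh hMζ
  exact UNO.exists_reconstruct_eq hW hT hlam hβ hβ_lattice hx hxβ hI k₀ hk₀ (he ω) hbdd h1 hζ hTh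
    hh hMζ
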